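/- **Convergence of the optimal shifted Gegenbauer quadrature (S-quadrature).** Let $L>0$. For $\alpha>-1/2$ let $C_n^{(\alpha)}$ be the Gegenbauer polynomials normalized by $C_n^{(\alpha)}(1)=1$, i.e. $C_0^{(\alpha)}=1$, $C_1^{(\alpha)}=x$, $(n+2\alpha)C_{n+1}^{(\alpha)}=2(n+\alpha)xC_n^{(\alpha)}-nC_{n-1}^{(\alpha)}$ for $n\ge 1$ (so $C_n^{(0)}=T_n$ is the Chebyshev polynomial), let $K_n^{(\alpha)}$ be the leading coefficient of $C_n^{(\alpha)}$, and put $C_{L,n}^{(\alpha)}(x)=C_n^{(\alpha)}(2x/L-1)$ and $\lambda_{L,n}^{(\alpha)}=\int_0^L C_{L,n}^{(\alpha)}(x)^2\,(Lx-x^2)^{\alpha-1/2}\,dx$. Let $z_0,\dots,z_m$ be the zeros of $C_{L,m+1}^{(\alpha)}$, with Christoffel numbers $\varpi_k=\bigl(\sum_{j=0}^m C_{L,j}^{(\alpha)}(z_k)^2/\lambda_{L,j}^{(\alpha)}\bigr)^{-1}$. For $x\in[0,L]$ the shifted Gegenbauer quadrature with parameter $\alpha$ for $\int_0^x f$ is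 $$Q_m^{(\alpha)}f(x)=\sum_{k=0}^m p_k(x)\,f(z_k),\qquad p_k(x)=\varpi_k\sum_{j=0}^m \frac{C_{L,j}^{(\alpha)}(z_k)}{\lambda_{L,j}^{(\alpha)}}\int_0^x C_{L,j}^{(\alpha)}(t)\,dt .$$ Given integration nodes $x_0,\dots,x_n\in[0,L]$, the optimal S-quadrature is $Q_m^{(\alpha_i^*)}f(x_i)$, $i=0,\dots,n$, where $\alpha_i^*=\alpha_i^*(m)$ is a minimizer over $\alpha>-1/2$ of $\eta_{L,i,m}(\alpha)^2$, with $$\eta_{L,i,m}(\alpha)=\frac{2^m}{K_{m+1}^{(\alpha)}}\int_0^{x_i}C_{L,m+1}^{(\alpha)}(t)\,dt .$$ The optimal shifted Chebyshev quadrature is $Q_m^{(0)}f(x_i)$, $i=0,\dots,n$. Let $A>0$. If $f\in C^{m+1}[0,L]$ and $\|f^{(m+1)}\|_{L^\infty[0,L]}\le A$, then the optimal S-quadrature converges to the optimal shifted Chebyshev quadrature in the $L^\infty$-norm as $m\to\infty$, uniformly in the function and in the integration nodes. That is, for every $\varepsilon>0$ there is $M=M(L,A,\varepsilon)$ such that for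 all $m\ge M$, $m\ge 1$, all $f\in C^{m+1}[0,L]$ with $\|f^{(m+1)}\|_{L^\infty[0,L]}\le A$, all $n\ge 0$, all $x_0,\dots,x_n\in[0,L]$ and all minimizers $\alpha_0^*,\dots,\alpha_n^*$ as above, $$\max_{0\le i\le n}\bigl|Q_m^{(\alpha_i^*)}f(x_i)-Q_m^{(0)}f(x_i)\bigr|<\varepsilon .$$ -/

import Mathlib

open Polynomial Set

noncomputable section

/-- The Gegenbauer polynomials `C_n^(α)`, standardized by `C_n^(α)(1) = 1`, through
`(n + 2α) C_{n+1} = 2 (n + α) x C_n - n C_{n-1}` for `n ≥ 1`, with `C_0 = 1` and `C_1 = x`.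
(For `α > -1/2` the factor `n + 2α` is positive.) -/
def gegenbauer (α : ℝ) : ℕ → ℝ[X]
  | 0 => 1
  | 1 => X
  | n + 2 => C (((n : ℝ) + 1 + 2 * α)⁻¹) *
      (C (2 * ((n : ℝ) + 1 + α)) * X * gegenbauer α (n + 1) - C ((n : ℝ) + 1) * gegenbauer α n)

/-- For `α = 0` these are the Chebyshev polynomials of the first kind. -/
theorem gegenbauer_zero_eq_chebyshev_T (n : ℕ) : gegenbauer 0 n = Chebyshev.T ℝ n := by
  induction n using Nat.twoStepInduction with
  | zero => simp [gegenbauer]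
  | one => simp [gegenbauer]
  | more n ih0 ih1 =>
    have h : (n : ℝ) + 1 ≠ 0 := by positivity
    have h2 : C (((n : ℝ) + 1)⁻¹) * C ((n : ℝ) + 1) = 1 := by
      rw [← C_mul, inv_mul_cancel₀ h, C_1]
    have h3 : C (2 : ℝ) = (2 : ℝ[X]) := rfl
    have h4 := Chebyshev.T_add_two ℝ (n : ℤ)
    push_cast at ih1 ⊢
    simp only [h4, gegenbauer, ih0, ih1, mul_zero, add_zero]
    rw [C_mul (a := 2), h3]
    linear_combination (2 * X * Chebyshev.T ℝ ((n : ℤ) + 1) - Chebyshev.T ℝ (n : ℤ)) * h2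

/-- The shifted Gegenbauer polynomial `C_{L,n}^(α)(x) = C_n^(α)(2x/L - 1)` on `[0, L]`. -/
def shiftedGegenbauer (L α : ℝ) (n : ℕ) : ℝ[X] :=
  (gegenbauer α n).comp (C (2 / L) * X - 1)

/-- `λ_{L,n}^(α)`: the squared norm of `C_{L,n}^(α)` for the weight `(L x - x²)^(α - 1/2)` on
`[0, L]`. -/
def shiftedNormSq (L α : ℝ) (n : ℕ) : ℝ :=
  ∫ x in (0 : ℝ)..L, (shiftedGegenbauer L α n).eval x ^ 2 * (L * x - x ^ 2) ^ (α - 1 / 2)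

/-- The shifted Gegenbauer-Gauss nodes: the (`m + 1`) zeros of `C_{L,m+1}^(α)`. -/
def shiftedNodes (L α : ℝ) (m : ℕ) : Finset ℝ :=
  (shiftedGegenbauer L α (m + 1)).roots.toFinset

/-- The Christoffel number `ϖ_{L,m}^(α)` of a node `z`. -/
def shiftedChristoffel (L α : ℝ) (m : ℕ) (z : ℝ) : ℝ :=
  (∑ j ∈ Finset.range (m + 1),
    (shiftedNormSq L α j)⁻¹ * (shiftedGegenbauer L α j).eval z ^ 2)⁻¹

/-- The entry, at the integration node `x` (row) and the interpolation node `z` (column), of the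
rectangular shifted Gegenbauer integration matrix with parameter `α`. -/
def integrationEntry (L α : ℝ) (m : ℕ) (x z : ℝ) : ℝ :=
  shiftedChristoffel L α m z * ∑ j ∈ Finset.range (m + 1),
    (shiftedNormSq L α j)⁻¹ * (shiftedGegenbauer L α j).eval z *
      ∫ t in (0 : ℝ)..x, (shiftedGegenbauer L α j).eval t

/-- The shifted Gegenbauer quadrature with parameter `α` for `∫_0^x f`, using the `m + 1` shifted
Gegenbauer-Gauss nodes of parameter `α`. -/
def gegenbauerQuadrature (L α : ℝ) (m : ℕ) (f : ℝ → ℝ) (x : ℝ) : ℝ :=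
  ∑ z ∈ shiftedNodes L α m, integrationEntry L α m x z * f z

/-- The shifted Chebyshev quadrature for `∫_0^x f`: the case `α = 0`. -/
def chebyshevQuadrature (L : ℝ) (m : ℕ) (f : ℝ → ℝ) (x : ℝ) : ℝ :=
  gegenbauerQuadrature L 0 m f x

/-- `η_{L,m}(α) = (2^m / K_{m+1}^(α)) ∫_0^x C_{L,m+1}^(α)` at the integration node `x`, where
`K_{m+1}^(α)` is the leading coefficient of `C_{m+1}^(α)`. -/
def quadratureEta (L : ℝ) (m : ℕ) (x α : ℝ) : ℝ :=
  2 ^ m / (gegenbauer α (m + 1)).leadingCoeff *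
    ∫ t in (0 : ℝ)..x, (shiftedGegenbauer L α (m + 1)).eval t

/-- `α` is an optimal Gegenbauer parameter for the integration node `x`: it minimizes `η²` over
the parameters greater than `-1/2`. -/
def IsOptimalParameter (L : ℝ) (m : ℕ) (x α : ℝ) : Prop :=
  α ∈ Ioi (-1 / 2 : ℝ) ∧ IsMinOn (fun β => quadratureEta L m x β ^ 2) (Ioi (-1 / 2 : ℝ)) α

end

/-! Both quadratures integrate an interpolating polynomial of `f`. For every α > -1/2 the m+1 nodes
are distinct and lie in (0, L), so the interpolation remainder is at most A L^(m+1)/(m+1)! on [0,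
L], whatever α is. Hence each quadrature is within A L · L^(m+1)/(m+1)! of the integral of `f`, and
the triangle inequality gives the claim.

The work is to extract this from the recurrence that defines the polynomials. A derivative identity
and integration by parts give orthogonality; orthogonality gives the norm ratios, hence
`christoffel_darboux`. That formula shows that the zeros are simple and that the kernels at the
nodes are multiples of the Lagrange basis (`gegenbauerQuadrature_eq_integral`). Orthogonality also
puts m+1 zeros inside (0, L) (`card_shiftedNodes_filter`). -/

/-! ### Algebra of Gegenbauer polynomials -/

/-- The three-term recurrence with the denominator cleared. -/
theorem gegenbauer_recurrence {α : ℝ} (hα : -1 / 2 < α) (n : ℕ) :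
    C ((n : ℝ) + 1 + 2 * α) * gegenbauer α (n + 2) =
      C (2 * ((n : ℝ) + 1 + α)) * X * gegenbauer α (n + 1) - C ((n : ℝ) + 1) * gegenbauer α n := by
  have h : (n : ℝ) + 1 + 2 * α ≠ 0 := by
    have : (0 : ℝ) ≤ n := n.cast_nonneg
    intro h; linarith
  rw [gegenbauer, ← mul_assoc, ← C_mul, mul_inv_cancel₀ h, C_1, one_mul]

/-- The two relations are proved together: the first at n+1 is the second at n rewritten by the
recurrence, and the second at n+1 comes from differentiating the recurrence and using both at n. -/
theorem gegenbauer_derivative {α : ℝ} (hα : -1 / 2 < α) (n : ℕ) :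
    (1 - X ^ 2) * derivative (gegenbauer α n) =
      C ((n : ℝ) + 2 * α) * (X * gegenbauer α n - gegenbauer α (n + 1)) ∧
    (1 - X ^ 2) * derivative (gegenbauer α (n + 1)) =
      C ((n : ℝ) + 1) * (gegenbauer α n - X * gegenbauer α (n + 1)) := by
  induction n with
  | zero => simp [gegenbauer]; ring
  | succ n ih =>
    obtain ⟨ih1, ih2⟩ := ih
    have hr := gegenbauer_recurrence hα n
    have h : (C ((n : ℝ) + 1 + 2 * α) : ℝ[X]) ≠ 0 := by
      rw [Ne, C_eq_zero]
      have : (0 : ℝ) ≤ n := n.cast_nonneg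
      intro h; linarith
    have hd := congrArg derivative hr
    simp only [derivative_mul, derivative_C, derivative_X, derivative_sub, zero_mul, zero_add] at hd
    simp only [C_add, C_mul, Nat.cast_add, Nat.cast_one, C_1, map_ofNat] at *
    refine ⟨?_, ?_⟩
    · linear_combination ih2 + hr
    · refine mul_left_cancel₀ h ?_
      linear_combination (1 - X ^ 2) * hd + 2 * (C (n : ℝ) + 1 + C α) * X * ih2 -
        (C (n : ℝ) + 1) * ih1 + (C (n : ℝ) + 1 + 1) * X * hr

theorem gegenbauer_natDegree {α : ℝ} (hα : -1 / 2 < α) (n : ℕ) :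
    (gegenbauer α n).natDegree = n := by
  have key : ∀ n : ℕ, (gegenbauer α n).natDegree ≤ n ∧ 0 < (gegenbauer α n).coeff n := by
    intro n
    induction n using Nat.twoStepInduction with
    | zero => simp [gegenbauer]
    | one => simp [gegenbauer]
    | more n ih0 ih1 =>
      have hn : (0 : ℝ) ≤ n := n.cast_nonneg
      have h1 : 0 < (n : ℝ) + 1 + 2 * α := by linarith
      have h2 : 0 < (n : ℝ) + 1 + α := by linarith
      constructor
      · rw [gegenbauer]
        refine (natDegree_C_mul_le _ _).trans ((natDegree_sub_le _ _).trans (max_le ?_ ?_))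
        · rw [mul_assoc]
          refine (natDegree_C_mul_le _ _).trans (natDegree_mul_le.trans ?_)
          rw [natDegree_X]; omega
        · exact (natDegree_C_mul_le _ _).trans (ih0.1.trans (by omega))
      · rw [gegenbauer, coeff_C_mul, coeff_sub, mul_assoc, coeff_C_mul, coeff_C_mul, coeff_X_mul,
          coeff_eq_zero_of_natDegree_lt (ih0.1.trans_lt (by omega : n < n + 2))]
        have := ih1.2
        simp only [mul_zero, sub_zero]
        positivity
  exact le_antisymm (key n).1 (le_natDegree_of_ne_zero (key n).2.ne')

theorem shiftedGegenbauer_zero (L α : ℝ) : shiftedGegenbauer L α 0 = 1 := by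
  simp [shiftedGegenbauer, gegenbauer]

theorem shiftedGegenbauer_one (L α : ℝ) : shiftedGegenbauer L α 1 = C (2 / L) * X - 1 := by
  simp [shiftedGegenbauer, gegenbauer]

theorem shiftedGegenbauer_natDegree {L α : ℝ} (hL : 0 < L) (hα : -1 / 2 < α) (n : ℕ) :
    (shiftedGegenbauer L α n).natDegree = n := by
  have : (C (2 / L) * X - 1 : ℝ[X]).natDegree = 1 := by
    rw [← C_1, natDegree_sub_C]; exact natDegree_C_mul_X _ (by positivity)
  rw [shiftedGegenbauer, natDegree_comp, gegenbauer_natDegree hα n, this, mul_one]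

theorem shiftedGegenbauer_ne_zero {L α : ℝ} (hL : 0 < L) (hα : -1 / 2 < α) (n : ℕ) :
    shiftedGegenbauer L α n ≠ 0 := by
  rcases n with - | n
  · rw [shiftedGegenbauer_zero]; exact one_ne_zero
  · exact ne_zero_of_natDegree_gt (n := 0)
      (by rw [shiftedGegenbauer_natDegree hL hα]; exact n.succ_pos)

theorem shiftedGegenbauer_recurrence {α : ℝ} (L : ℝ) (hα : -1 / 2 < α) (n : ℕ) :
    C ((n : ℝ) + 1 + 2 * α) * shiftedGegenbauer L α (n + 2) =
      C (2 * ((n : ℝ) + 1 + α)) * (C (2 / L) * X - 1) * shiftedGegenbauer L α (n + 1) -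
        C ((n : ℝ) + 1) * shiftedGegenbauer L α n := by
  have := congrArg (fun p : ℝ[X] => p.comp (C (2 / L) * X - 1)) (gegenbauer_recurrence hα n)
  simpa only [mul_comp, sub_comp, C_comp, X_comp, shiftedGegenbauer] using this

theorem shiftedGegenbauer_derivative {L α : ℝ} (hL : 0 < L) (hα : -1 / 2 < α) (n : ℕ) :
    (C L * X - X ^ 2) * derivative (shiftedGegenbauer L α n) =
      C (L / 2) * C ((n : ℝ) + 2 * α) * ((C (2 / L) * X - 1) * shiftedGegenbauer L α n -
        shiftedGegenbauer L α (n + 1)) := by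
  have := congrArg (fun p : ℝ[X] => p.comp (C (2 / L) * X - 1)) (gegenbauer_derivative hα n).1
  simp only [mul_comp, sub_comp, C_comp, X_comp, pow_comp, one_comp] at this
  rw [shiftedGegenbauer, derivative_comp]
  simp only [derivative_sub, derivative_mul, derivative_C, derivative_X, derivative_one, zero_mul,
    mul_one, zero_add, sub_zero]
  have h : C (L / 2) * C (2 / L) = (1 : ℝ[X]) := by
    rw [← C_mul, ← C_1]; congr 1; field_simp
  have h2 : C L = 2 * (C (L / 2) : ℝ[X]) := by
    rw [show (2 : ℝ[X]) = C 2 from rfl, ← C_mul]; congr 1; ring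
  rw [shiftedGegenbauer, mul_assoc (C (L / 2)), ← this, h2]
  set D := (derivative (gegenbauer α n)).comp (C (2 / L) * X - 1)
  linear_combination X ^ 2 * C (2 / L) * D * h

/-! ### The weight and orthogonality -/

/-- On the left half the weight is x^r times a continuous factor; the reflection x ↦ L - x gives the
right half. -/
theorem intervalIntegrable_jacobiWeight {L r : ℝ} (hL : 0 < L) (hr : -1 < r) :
    IntervalIntegrable (fun x : ℝ => (L * x - x ^ 2) ^ r) MeasureTheory.volume 0 L := by
  have hleft : IntervalIntegrable (fun x : ℝ => (L * x - x ^ 2) ^ r)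
      MeasureTheory.volume 0 (L / 2) := by
    have h : IntervalIntegrable (fun x : ℝ => x ^ r * (L - x) ^ r)
        MeasureTheory.volume 0 (L / 2) := by
      refine (intervalIntegral.intervalIntegrable_rpow' hr).mul_continuousOn ?_
      rw [uIcc_of_le (by linarith)]
      refine ContinuousOn.rpow_const (by fun_prop) fun x hx => Or.inl ?_
      have := hx.2
      intro h; linarith
    refine h.congr fun x hx => ?_
    rw [uIoc_of_le (by linarith)] at hx
    have := hx.2
    rw [← Real.mul_rpow hx.1.le (by linarith)]
    congr 1; ring
  refine hleft.trans ?_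
  have h := (hleft.comp_sub_left L).symm
  rw [sub_zero, sub_half] at h
  refine h.congr fun x _ => ?_
  congr 1; ring

/-- Integration of a polynomial against the weight `(L x - x²)^(α - 1/2)` on `[0, L]`. -/
noncomputable def weightedIntegral (L α : ℝ) (q : ℝ[X]) : ℝ :=
  ∫ x in (0 : ℝ)..L, q.eval x * (L * x - x ^ 2) ^ (α - 1 / 2)

section weighted

variable {L α : ℝ}

theorem intervalIntegrable_eval_mul_weight (hL : 0 < L) (hα : -1 / 2 < α) (q : ℝ[X]) :
    IntervalIntegrable (fun x : ℝ => q.eval x * (L * x - x ^ 2) ^ (α - 1 / 2))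
      MeasureTheory.volume 0 L :=
  (intervalIntegrable_jacobiWeight hL (by linarith)).continuousOn_mul q.continuous.continuousOn

theorem weightedIntegral_add (hL : 0 < L) (hα : -1 / 2 < α) (p q : ℝ[X]) :
    weightedIntegral L α (p + q) = weightedIntegral L α p + weightedIntegral L α q := by
  rw [weightedIntegral, weightedIntegral, weightedIntegral, ← intervalIntegral.integral_add
    (intervalIntegrable_eval_mul_weight hL hα p) (intervalIntegrable_eval_mul_weight hL hα q)]
  simp only [eval_add, add_mul]

theorem weightedIntegral_C_mul (L α c : ℝ) (q : ℝ[X]) :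
    weightedIntegral L α (C c * q) = c * weightedIntegral L α q := by
  rw [weightedIntegral, weightedIntegral, ← intervalIntegral.integral_const_mul]
  simp only [eval_mul, eval_C, mul_assoc]

theorem weightedIntegral_sub (hL : 0 < L) (hα : -1 / 2 < α) (p q : ℝ[X]) :
    weightedIntegral L α (p - q) = weightedIntegral L α p - weightedIntegral L α q := by
  have h := weightedIntegral_add hL hα p (C (-1) * q)
  rw [weightedIntegral_C_mul] at h
  have : p - q = p + C (-1) * q := by simp [sub_eq_add_neg]
  rw [this, h]; ring

theorem weightedIntegral_pos (hL : 0 < L) (hα : -1 / 2 < α) {q : ℝ[X]} (hq : q ≠ 0)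
    (h : ∀ x ∈ Ioo 0 L, 0 ≤ q.eval x) : 0 < weightedIntegral L α q := by
  have hw : ∀ x ∈ Ioo 0 L, 0 < (L * x - x ^ 2) ^ (α - 1 / 2) := fun x hx =>
    Real.rpow_pos_of_pos (by nlinarith [mul_pos hx.1 (sub_pos.2 hx.2)]) _
  have hae : ∀ᵐ x ∂MeasureTheory.volume.restrict (Ioo 0 L), x ∈ Ioo 0 L :=
    MeasureTheory.ae_restrict_mem measurableSet_Ioo
  have hI := (intervalIntegrable_eval_mul_weight hL hα q)
  rw [intervalIntegrable_iff_integrableOn_Ioo_of_le hL.le] at hI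
  rw [weightedIntegral, intervalIntegral.integral_of_le hL.le,
    MeasureTheory.integral_Ioc_eq_integral_Ioo,
    MeasureTheory.setIntegral_pos_iff_support_of_nonneg_ae _ hI]
  · have hsub : Ioo 0 L \ (q.roots.toFinset : Set ℝ) ⊆
        (Function.support fun x : ℝ => q.eval x * (L * x - x ^ 2) ^ (α - 1 / 2)) ∩ Ioo 0 L := by
      rintro x ⟨hx, hx'⟩
      refine ⟨?_, hx⟩
      rw [Function.mem_support]
      refine mul_ne_zero (fun h0 => hx' ?_) (hw x hx).ne'
      simpa [hq] using h0
    refine lt_of_lt_of_le ?_ (MeasureTheory.measure_mono hsub)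
    rw [MeasureTheory.measure_sdiff_null (Finset.measure_zero _ _), Real.volume_Ioo]
    simpa using hL
  · filter_upwards [hae] with x hx using mul_nonneg (h x hx) (hw x hx).le

/-- With the weight, the integrand is the derivative of G · (Lx - x²)^(α+1/2), which vanishes at
both endpoints. -/
theorem weightedIntegral_total_derivative (hL : 0 < L) (hα : -1 / 2 < α) (G : ℝ[X]) :
    weightedIntegral L α ((C L * X - X ^ 2) * derivative G +
      C (α + 1 / 2) * (C L - 2 * X) * G) = 0 := by
  have hr : 0 < α + 1 / 2 := by linarith
  have := intervalIntegral.integral_eq_sub_of_hasDerivAt_of_le (a := 0) (b := L)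
    (f := fun x => G.eval x * (L * x - x ^ 2) ^ (α + 1 / 2))
    (f' := fun x => ((C L * X - X ^ 2) * derivative G +
      C (α + 1 / 2) * (C L - 2 * X) * G).eval x * (L * x - x ^ 2) ^ (α - 1 / 2)) hL.le
    (G.continuous.continuousOn.mul
      (ContinuousOn.rpow_const (by fun_prop) fun _ _ => Or.inr hr.le))
    (fun x hx => ?_) (intervalIntegrable_eval_mul_weight hL hα _)
  · rw [weightedIntegral, this]
    have h0 : L * L - L ^ 2 = 0 := by ring
    rw [h0, zero_pow two_ne_zero, mul_zero, sub_zero, Real.zero_rpow hr.ne', mul_zero, mul_zero,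
      sub_zero]
  · have hpos : 0 < L * x - x ^ 2 := by nlinarith [mul_pos hx.1 (sub_pos.2 hx.2)]
    have h1 : HasDerivAt (fun x : ℝ => L * x - x ^ 2) (L - 2 * x) x := by
      have := ((hasDerivAt_id' x).const_mul L).fun_sub (hasDerivAt_pow 2 x)
      exact this.congr_deriv (by norm_num)
    have h2 := (G.hasDerivAt x).mul (h1.rpow_const (p := α + 1 / 2) (Or.inl hpos.ne'))
    refine h2.congr_deriv ?_
    have e1 : (L * x - x ^ 2) ^ (α + 1 / 2) =
        (L * x - x ^ 2) * (L * x - x ^ 2) ^ (α - 1 / 2) := by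
      rw [← Real.rpow_one_add' hpos.le (by linarith)]
      congr 1; ring
    rw [e1, show α + 1 / 2 - 1 = α - 1 / 2 by ring]
    simp only [eval_add, eval_mul, eval_sub, eval_C, eval_X, eval_pow, eval_ofNat]
    ring

/-- Integration by parts and the recurrence are two linear relations; eliminating the integral of
(2x/L - 1) C_{L,n+2} from them links index n+3 to n+1. -/
theorem weightedIntegral_shiftedGegenbauer (hL : 0 < L) (hα : -1 / 2 < α) (n : ℕ) :
    weightedIntegral L α (shiftedGegenbauer L α (n + 1)) = 0 := by
  have hL2 : C L = C (L / 2) * (2 : ℝ[X]) := by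
    rw [show (2 : ℝ[X]) = C 2 from rfl, ← C_mul]; congr 1; ring
  have h1 : C (L / 2) * C (2 / L) = (1 : ℝ[X]) := by
    rw [← C_mul, ← C_1]; congr 1; field_simp
  have hn : ∀ n : ℕ, (0 : ℝ) ≤ n := fun n => n.cast_nonneg
  have hstep : ∀ n : ℕ, (n : ℝ) *
      weightedIntegral L α ((C (2 / L) * X - 1) * shiftedGegenbauer L α (n + 1)) =
      (n + 1 + 2 * α) * weightedIntegral L α (shiftedGegenbauer L α (n + 2)) := by
    intro n
    have h := weightedIntegral_total_derivative hL hα (shiftedGegenbauer L α (n + 1))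
    have e : (C L * X - X ^ 2) * derivative (shiftedGegenbauer L α (n + 1)) +
        C (α + 1 / 2) * (C L - 2 * X) * shiftedGegenbauer L α (n + 1) =
        C (L / 2) * (C (n : ℝ) * ((C (2 / L) * X - 1) * shiftedGegenbauer L α (n + 1)) -
          C ((n : ℝ) + 1 + 2 * α) * shiftedGegenbauer L α (n + 2)) := by
      rw [shiftedGegenbauer_derivative hL hα, hL2]
      have h2 : C (α + 1 / 2) * 2 = (C (2 * α + 1) : ℝ[X]) := by
        rw [show (2 : ℝ[X]) = C 2 from rfl, ← C_mul]; congr 1; ring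
      simp only [C_add, C_mul, Nat.cast_add, Nat.cast_one, C_1, map_ofNat] at h2 ⊢
      linear_combination (C (L / 2) - X) * shiftedGegenbauer L α (n + 1) * h2 +
        (2 * C α + 1) * X * shiftedGegenbauer L α (n + 1) * h1
    rw [e, weightedIntegral_C_mul, weightedIntegral_sub hL hα, weightedIntegral_C_mul,
      weightedIntegral_C_mul] at h
    have := (mul_eq_zero.1 h).resolve_left (by positivity)
    linarith
  induction n using Nat.twoStepInduction with
  | zero =>
    have h := weightedIntegral_total_derivative hL hα 1
    have e : (C L * X - X ^ 2) * derivative (1 : ℝ[X]) + C (α + 1 / 2) * (C L - 2 * X) * 1 =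
        C (-(α + 1 / 2) * L) * shiftedGegenbauer L α 1 := by
      rw [shiftedGegenbauer_one, hL2, derivative_one, C_mul, hL2, C_neg]
      linear_combination 2 * C (α + 1 / 2) * X * h1
    rw [e, weightedIntegral_C_mul] at h
    exact (mul_eq_zero.1 h).resolve_left (mul_ne_zero (by intro h; linarith) hL.ne')
  | one =>
    have h := hstep 0
    simp only [Nat.cast_zero, zero_mul, zero_add] at h
    exact (mul_eq_zero.1 h.symm).resolve_left (by intro h; linarith)
  | more n ih _ =>
    have h := hstep (n + 1)
    have hr := congrArg (weightedIntegral L α) (shiftedGegenbauer_recurrence L hα (n + 1))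
    rw [mul_assoc, weightedIntegral_sub hL hα, weightedIntegral_C_mul, weightedIntegral_C_mul,
      weightedIntegral_C_mul, ih] at hr
    simp only [Nat.cast_add, Nat.cast_one, add_assoc, Nat.reduceAdd] at h hr ⊢
    have := hn n
    have h3 : ((n : ℝ) + (1 + (1 + 2 * α))) * (n + 2 * α + 3) *
        weightedIntegral L α (shiftedGegenbauer L α (n + 3)) = 0 := by
      linear_combination (-2 * ((n : ℝ) + (1 + (1 + α)))) * h - (n + 1) * hr
    exact (mul_eq_zero.1 h3).resolve_left
      (mul_ne_zero (by intro h; linarith) (by intro h; linarith))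

/-- By the recurrence, each factor X lowers the index by at most one, so k < n factors never reach
index 0. -/
theorem weightedIntegral_X_pow_mul (hL : 0 < L) (hα : -1 / 2 < α) (k n : ℕ) (h : k < n) :
    weightedIntegral L α (X ^ k * shiftedGegenbauer L α n) = 0 := by
  induction k generalizing n with
  | zero =>
    obtain ⟨n, rfl⟩ := Nat.exists_eq_succ_of_ne_zero h.ne'
    rw [pow_zero, one_mul]
    exact weightedIntegral_shiftedGegenbauer hL hα n
  | succ k ih =>
    obtain ⟨n, rfl⟩ := Nat.exists_eq_add_of_le' (show 1 ≤ n by omega)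
    have hn : (0 : ℝ) ≤ n := n.cast_nonneg
    have e : C (2 * ((n : ℝ) + 1 + α) * (2 / L)) * (X ^ (k + 1) * shiftedGegenbauer L α (n + 1)) =
        C ((n : ℝ) + 1 + 2 * α) * (X ^ k * shiftedGegenbauer L α (n + 2)) +
        (C (2 * ((n : ℝ) + 1 + α)) * (X ^ k * shiftedGegenbauer L α (n + 1)) +
        C ((n : ℝ) + 1) * (X ^ k * shiftedGegenbauer L α n)) := by
      rw [C_mul (b := 2 / L)]
      linear_combination (-X ^ k) * shiftedGegenbauer_recurrence L hα n
    have h := congrArg (weightedIntegral L α) e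
    rw [weightedIntegral_add hL hα, weightedIntegral_add hL hα, weightedIntegral_C_mul,
      weightedIntegral_C_mul, weightedIntegral_C_mul, weightedIntegral_C_mul, ih _ (by omega),
      ih _ (by omega), ih _ (by omega)] at h
    simp only [mul_zero, add_zero] at h
    have h1 : 0 < (n : ℝ) + 1 + α := by linarith
    exact (mul_eq_zero.1 h).resolve_left (by positivity)

/-- Orthogonality to all polynomials of lower degree. -/
theorem weightedIntegral_mul_shiftedGegenbauer (hL : 0 < L) (hα : -1 / 2 < α) {q : ℝ[X]} {n : ℕ}
    (h : q.natDegree < n) : weightedIntegral L α (q * shiftedGegenbauer L α n) = 0 := by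
  have key : ∀ s : Finset ℕ, (∀ k ∈ s, k < n) →
      weightedIntegral L α ((∑ k ∈ s, C (q.coeff k) * X ^ k) * shiftedGegenbauer L α n) = 0 := by
    intro s
    induction s using Finset.induction_on with
    | empty => simp [weightedIntegral]
    | insert a s ha ih =>
      intro hs
      rw [Finset.sum_insert ha, add_mul, weightedIntegral_add hL hα, mul_assoc,
        weightedIntegral_C_mul, weightedIntegral_X_pow_mul hL hα _ _ (hs a (by simp)),
        ih fun k hk => hs k (by simp [hk]), mul_zero, add_zero]
  conv_lhs => rw [q.as_sum_range' n h]
  simp only [← C_mul_X_pow_eq_monomial]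
  exact key _ fun k hk => Finset.mem_range.1 hk

/-! ### Norms and the Christoffel-Darboux formula -/

theorem shiftedNormSq_eq_weightedIntegral (L α : ℝ) (n : ℕ) :
    shiftedNormSq L α n =
      weightedIntegral L α (shiftedGegenbauer L α n * shiftedGegenbauer L α n) := by
  simp only [shiftedNormSq, weightedIntegral, eval_mul, sq]

theorem shiftedNormSq_pos (hL : 0 < L) (hα : -1 / 2 < α) (n : ℕ) : 0 < shiftedNormSq L α n := by
  rw [shiftedNormSq_eq_weightedIntegral]
  have := shiftedGegenbauer_ne_zero hL hα n
  refine weightedIntegral_pos hL hα (mul_ne_zero this this) fun x _ => ?_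
  rw [eval_mul]; exact mul_self_nonneg _

/-- Kept apart from the general ratio, which at this index would carry a factor α on both sides and
say nothing for α = 0. -/
theorem shiftedNormSq_zero (hL : 0 < L) (hα : -1 / 2 < α) :
    shiftedNormSq L α 0 = 2 * (1 + α) * shiftedNormSq L α 1 := by
  have h := congrArg (weightedIntegral L α) (shiftedGegenbauer_recurrence L hα 0)
  have h2 := weightedIntegral_shiftedGegenbauer hL hα 1
  rw [mul_assoc, weightedIntegral_sub hL hα, weightedIntegral_C_mul, weightedIntegral_C_mul,
    weightedIntegral_C_mul, h2, ← shiftedGegenbauer_one L α,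
    ← shiftedNormSq_eq_weightedIntegral] at h
  rw [shiftedNormSq_eq_weightedIntegral L α 0, shiftedGegenbauer_zero, mul_one]
  rw [shiftedGegenbauer_zero, Nat.cast_zero] at h
  linarith

/-- Two consecutive recurrences, paired with C_{L,n+2} and C_{L,n+1}, share one mixed integral;
orthogonality removes the other cross terms. -/
theorem shiftedNormSq_succ (hL : 0 < L) (hα : -1 / 2 < α) (n : ℕ) :
    ((n : ℝ) + 1 + 2 * α) * (n + 2 + α) * shiftedNormSq L α (n + 2) =
      (n + 1 + α) * (n + 2) * shiftedNormSq L α (n + 1) := by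
  set P := shiftedGegenbauer L α with hP
  set S : ℝ[X] := C (2 / L) * X - 1
  have hd := shiftedGegenbauer_natDegree hL hα
  have e1 : C ((n : ℝ) + 1 + 2 * α) * (P (n + 2) * P (n + 2)) =
      C (2 * ((n : ℝ) + 1 + α)) * (S * P (n + 1) * P (n + 2)) -
        C ((n : ℝ) + 1) * (P n * P (n + 2)) := by
    linear_combination P (n + 2) * shiftedGegenbauer_recurrence L hα n
  have e2 : C (((n + 1 : ℕ) : ℝ) + 1 + 2 * α) * (P (n + 1) * P (n + 3)) =
      C (2 * (((n + 1 : ℕ) : ℝ) + 1 + α)) * (S * P (n + 1) * P (n + 2)) -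
        C (((n + 1 : ℕ) : ℝ) + 1) * (P (n + 1) * P (n + 1)) := by
    linear_combination P (n + 1) * shiftedGegenbauer_recurrence L hα (n + 1)
  have h1 := congrArg (weightedIntegral L α) e1
  have h2 := congrArg (weightedIntegral L α) e2
  rw [weightedIntegral_sub hL hα, weightedIntegral_C_mul, weightedIntegral_C_mul,
    weightedIntegral_C_mul, hP, ← shiftedNormSq_eq_weightedIntegral,
    weightedIntegral_mul_shiftedGegenbauer (q := shiftedGegenbauer L α n) hL hα
      (by rw [hd]; omega)] at h1
  rw [weightedIntegral_sub hL hα, weightedIntegral_C_mul, weightedIntegral_C_mul,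
    weightedIntegral_C_mul, hP, ← shiftedNormSq_eq_weightedIntegral,
    weightedIntegral_mul_shiftedGegenbauer (q := shiftedGegenbauer L α (n + 1)) hL hα
      (by rw [hd]; omega)] at h2
  push_cast at h2
  linear_combination (n + 2 + α) * h1 - (n + 1 + α) * h2

/-- The Christoffel-Darboux formula. -/
theorem christoffel_darboux (hL : 0 < L) (hα : -1 / 2 < α) (n : ℕ) (z t : ℝ) :
    2 * ((n : ℝ) + 1 + α) * shiftedNormSq L α (n + 1) * (2 / L * (t - z)) *
      ∑ j ∈ Finset.range (n + 2), (shiftedNormSq L α j)⁻¹ * (shiftedGegenbauer L α j).eval z *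
        (shiftedGegenbauer L α j).eval t =
    (n + 1 + 2 * α) *
      ((shiftedGegenbauer L α (n + 2)).eval t * (shiftedGegenbauer L α (n + 1)).eval z -
        (shiftedGegenbauer L α (n + 1)).eval t * (shiftedGegenbauer L α (n + 2)).eval z) := by
  have hr : ∀ (n : ℕ) (x : ℝ), ((n : ℝ) + 1 + 2 * α) * (shiftedGegenbauer L α (n + 2)).eval x =
      2 * ((n : ℝ) + 1 + α) * (2 / L * x - 1) * (shiftedGegenbauer L α (n + 1)).eval x -
        ((n : ℝ) + 1) * (shiftedGegenbauer L α n).eval x := by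
    intro n x
    simpa using congrArg (eval x) (shiftedGegenbauer_recurrence L hα n)
  induction n with
  | zero =>
    have h1 := (shiftedNormSq_pos hL hα 1).ne'
    have hα1 : 1 + α ≠ 0 := by intro h; linarith
    have ht := hr 0 t
    have hz := hr 0 z
    have hs : ∀ a b c : ℝ, 2 * (1 + α) * shiftedNormSq L α 1 * a *
        ((2 * (1 + α) * shiftedNormSq L α 1)⁻¹ + (shiftedNormSq L α 1)⁻¹ * b * c) =
        a + 2 * (1 + α) * a * b * c := by
      intro a b c
      field_simp
    simp only [Finset.sum_range_succ, Finset.sum_range_zero, shiftedNormSq_zero hL hα,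
      shiftedGegenbauer_zero, shiftedGegenbauer_one, eval_one, eval_sub, eval_mul, eval_C, eval_X,
      Nat.cast_zero, zero_add, mul_one, hs] at ht hz ⊢
    linear_combination (2 / L * t - 1) * hz - (2 / L * z - 1) * ht
  | succ n ih =>
    rw [Finset.sum_range_succ, mul_add]
    set K := ∑ j ∈ Finset.range (n + 2), (shiftedNormSq L α j)⁻¹ *
      (shiftedGegenbauer L α j).eval z * (shiftedGegenbauer L α j).eval t
    have hn : (0 : ℝ) ≤ n := n.cast_nonneg
    have hl := shiftedNormSq_succ hL hα n
    have ht := hr (n + 1) t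
    have hz := hr (n + 1) z
    have h0 : (n : ℝ) + 1 + 2 * α ≠ 0 := by intro h; linarith
    push_cast at ht hz ⊢
    have hi : shiftedNormSq L α (n + 2) * (shiftedNormSq L α (n + 2))⁻¹ = 1 :=
      mul_inv_cancel₀ (shiftedNormSq_pos hL hα (n + 2)).ne'
    simp only [add_assoc, Nat.reduceAdd] at *
    -- The factor n + 1 + 2α lets the norm ratio trade λ_{n+2} for λ_{n+1}, so that `ih` applies.
    refine mul_left_cancel₀ h0 ?_
    linear_combination 2 * (2 / L * (t - z)) * K * hl + ((n : ℝ) + 2) * ih +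
      2 * ((n : ℝ) + 1 + 2 * α) * (n + 2 + α) * (2 / L * (t - z)) *
        (shiftedGegenbauer L α (n + 2)).eval z * (shiftedGegenbauer L α (n + 2)).eval t * hi -
      ((n : ℝ) + 1 + 2 * α) * ((shiftedGegenbauer L α (n + 2)).eval z * ht -
        (shiftedGegenbauer L α (n + 2)).eval t * hz)

end weighted

/-! ### Nodes and the interpolating polynomial -/

/-- The Christoffel-Darboux kernel with first argument `z`, as a polynomial in the second. -/
noncomputable def christoffelKernel (L α : ℝ) (m : ℕ) (z : ℝ) : ℝ[X] :=
  ∑ j ∈ Finset.range (m + 1),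
    C ((shiftedNormSq L α j)⁻¹ * (shiftedGegenbauer L α j).eval z) * shiftedGegenbauer L α j

theorem christoffelKernel_eval (L α : ℝ) (m : ℕ) (z t : ℝ) :
    (christoffelKernel L α m z).eval t = ∑ j ∈ Finset.range (m + 1),
      (shiftedNormSq L α j)⁻¹ * (shiftedGegenbauer L α j).eval z *
        (shiftedGegenbauer L α j).eval t := by
  simp only [christoffelKernel, eval_finsetSum, eval_mul, eval_C]

section nodes

variable {L α : ℝ}

theorem christoffelKernel_degree_lt (hL : 0 < L) (hα : -1 / 2 < α) (m : ℕ) (z : ℝ) :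
    (christoffelKernel L α m z).degree < (m + 1 : ℕ) := by
  refine (degree_sum_le _ _).trans_lt
    ((Finset.sup_lt_iff (WithBot.bot_lt_coe _)).2 fun j hj => ?_)
  refine (smul_eq_C_mul (R := ℝ) _ ▸ degree_smul_le _ _).trans_lt (degree_le_natDegree.trans_lt ?_)
  rw [shiftedGegenbauer_natDegree hL hα]
  exact_mod_cast Finset.mem_range.1 hj

theorem shiftedChristoffel_eq (L α : ℝ) (m : ℕ) (z : ℝ) :
    shiftedChristoffel L α m z = ((christoffelKernel L α m z).eval z)⁻¹ := by
  simp only [shiftedChristoffel, christoffelKernel_eval, sq, mul_assoc]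

theorem christoffelKernel_eval_self_pos (hL : 0 < L) (hα : -1 / 2 < α) (m : ℕ) (z : ℝ) :
    0 < (christoffelKernel L α m z).eval z := by
  rw [christoffelKernel_eval]
  have hpos := fun j => inv_pos.2 (shiftedNormSq_pos hL hα j)
  refine Finset.sum_pos' (fun j _ => ?_) ⟨0, by simp, ?_⟩
  · rw [mul_assoc]; exact mul_nonneg (hpos j).le (mul_self_nonneg _)
  · simpa [shiftedGegenbauer_zero] using shiftedNormSq_pos hL hα 0

/-- At a zero z one of the two Christoffel-Darboux terms drops out. The case m = 0 is direct, since
that formula starts with a sum of two terms. -/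
theorem X_sub_C_mul_christoffelKernel (hL : 0 < L) (hα : -1 / 2 < α) (m : ℕ) {z : ℝ}
    (hz : (shiftedGegenbauer L α (m + 1)).eval z = 0) :
    ∃ c : ℝ, (X - C z) * christoffelKernel L α m z = C c * shiftedGegenbauer L α (m + 1) := by
  rcases m with - | n
  · refine ⟨(shiftedNormSq L α 0)⁻¹ * (L / 2), Polynomial.funext fun t => ?_⟩
    simp only [zero_add, shiftedGegenbauer_one, eval_sub, eval_mul, eval_C, eval_X,
      eval_one] at hz ⊢
    simp only [christoffelKernel_eval, zero_add, Finset.sum_range_one, shiftedGegenbauer_zero,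
      eval_one, mul_one]
    have h : L / 2 * (2 / L) = 1 := by field_simp
    linear_combination (-(shiftedNormSq L α 0)⁻¹ * (L / 2)) * hz -
      (shiftedNormSq L α 0)⁻¹ * (t - z) * h
  · have hn : (0 : ℝ) ≤ n := n.cast_nonneg
    have h0 : 0 < (n : ℝ) + 1 + α := by linarith
    have h1 := shiftedNormSq_pos hL hα (n + 1)
    refine ⟨(2 * ((n : ℝ) + 1 + α) * shiftedNormSq L α (n + 1) * (2 / L))⁻¹ *
      ((n + 1 + 2 * α) * (shiftedGegenbauer L α (n + 1)).eval z), Polynomial.funext fun t => ?_⟩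
    have h := christoffel_darboux hL hα n z t
    rw [← christoffelKernel_eval, hz, mul_zero, sub_zero] at h
    rw [eval_mul, eval_mul, eval_sub, eval_X, eval_C, eval_C, mul_assoc, ← div_eq_inv_mul,
      eq_div_iff (by positivity)]
    linear_combination h

/-- Differentiating (X - z) K = c P at z gives K(z) = c P'(z), and K(z) > 0. -/
theorem shiftedGegenbauer_derivative_eval_ne_zero (hL : 0 < L) (hα : -1 / 2 < α) (m : ℕ) {z : ℝ}
    (hz : (shiftedGegenbauer L α (m + 1)).eval z = 0) :
    (derivative (shiftedGegenbauer L α (m + 1))).eval z ≠ 0 := by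
  obtain ⟨c, hc⟩ := X_sub_C_mul_christoffelKernel hL hα m hz
  have h := congrArg (fun p : ℝ[X] => (derivative p).eval z) hc
  intro h0
  have := christoffelKernel_eval_self_pos hL hα m z
  simp [derivative_mul, h0] at h
  exact this.ne' h

theorem christoffelKernel_eval_of_ne (hL : 0 < L) (hα : -1 / 2 < α) (m : ℕ) {z t : ℝ}
    (hz : (shiftedGegenbauer L α (m + 1)).eval z = 0)
    (ht : (shiftedGegenbauer L α (m + 1)).eval t = 0) (h : t ≠ z) :
    (christoffelKernel L α m z).eval t = 0 := by
  obtain ⟨c, hc⟩ := X_sub_C_mul_christoffelKernel hL hα m hz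
  have := congrArg (eval t) hc
  rw [eval_mul, eval_mul, ht, mul_zero, eval_sub, eval_X, eval_C] at this
  exact (mul_eq_zero.1 this).resolve_left (sub_ne_zero.2 h)

theorem mem_shiftedNodes (hL : 0 < L) (hα : -1 / 2 < α) (m : ℕ) (z : ℝ) :
    z ∈ shiftedNodes L α m ↔ (shiftedGegenbauer L α (m + 1)).eval z = 0 := by
  rw [shiftedNodes, Multiset.mem_toFinset, mem_roots (shiftedGegenbauer_ne_zero hL hα _), IsRoot]

theorem eval_nonneg_or_nonpos_of_ne_zero {a b : ℝ} {r : ℝ[X]} (h : ∀ x ∈ Ioo a b, r.eval x ≠ 0) :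
    (∀ x ∈ Ioo a b, 0 ≤ r.eval x) ∨ (∀ x ∈ Ioo a b, r.eval x ≤ 0) := by
  by_contra! hcon
  obtain ⟨⟨x, hx, hx0⟩, y, hy, hy0⟩ := hcon
  obtain ⟨z, hz, hz0⟩ := isPreconnected_Ioo.intermediate_value hx hy
    r.continuous.continuousOn ⟨hx0.le, hy0.le⟩
  exact h z hz hz0

/-- Let q be the product over the zeros in (0, L) and P = q r. With too few zeros, q P has weighted
integral 0 by orthogonality; but q P = q² r has constant sign there. -/
theorem card_shiftedNodes_filter (hL : 0 < L) (hα : -1 / 2 < α) (m : ℕ) :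
    m + 1 ≤ ((shiftedNodes L α m).filter fun z => z ∈ Ioo 0 L).card := by
  by_contra! hlt
  set S := (shiftedNodes L α m).filter fun z => z ∈ Ioo 0 L with hS
  set P := shiftedGegenbauer L α (m + 1) with hP
  have hP0 : P ≠ 0 := shiftedGegenbauer_ne_zero hL hα _
  set q : ℝ[X] := ∏ z ∈ S, (X - C z) with hq
  have hqm : q.Monic := monic_prod_of_monic _ _ fun z _ => monic_X_sub_C z
  have hqd : q.natDegree = S.card := by
    rw [hq, natDegree_prod_of_monic _ _ fun z _ => monic_X_sub_C z]; simp
  have hroot : ∀ z ∈ S, q.eval z = 0 := fun z hz => by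
    rw [hq, eval_prod]; exact Finset.prod_eq_zero hz (by simp)
  obtain ⟨r, hr⟩ : q ∣ P := by
    refine Finset.prod_dvd_of_coprime (fun a _ b _ hab =>
      pairwise_coprime_X_sub_C Function.injective_id hab) fun z hz => ?_
    exact dvd_iff_isRoot.2 ((mem_shiftedNodes hL hα m z).1 (Finset.mem_filter.1 hz).1)
  have hr0 : r ≠ 0 := by rintro rfl; exact hP0 (by rw [hr, mul_zero])
  have hrne : ∀ x ∈ Ioo 0 L, r.eval x ≠ 0 := by
    intro x hx h0
    have hPx : P.eval x = 0 := by rw [hr, eval_mul, h0, mul_zero]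
    have hxS : x ∈ S := Finset.mem_filter.2 ⟨(mem_shiftedNodes hL hα m x).2 hPx, hx⟩
    -- A common zero of q and r would be a double zero of P.
    refine shiftedGegenbauer_derivative_eval_ne_zero hL hα m hPx ?_
    rw [← hP, hr, derivative_mul, eval_add, eval_mul, eval_mul, h0, hroot x hxS]; simp
  have horth : weightedIntegral L α (q * P) = 0 :=
    weightedIntegral_mul_shiftedGegenbauer hL hα (by rw [hqd]; exact hlt)
  have hqP : q * P = q * q * r := by rw [hr]; ring
  have hne : q * P ≠ 0 := mul_ne_zero hqm.ne_zero hP0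
  rcases eval_nonneg_or_nonpos_of_ne_zero hrne with h | h
  · refine (weightedIntegral_pos hL hα hne fun x hx => ?_).ne' horth
    rw [hqP, eval_mul, eval_mul]
    exact mul_nonneg (mul_self_nonneg _) (h x hx)
  · have hneg : C (-1) * (q * P) ≠ 0 := mul_ne_zero (by simp) hne
    refine (weightedIntegral_pos hL hα hneg fun x hx => ?_).ne' ?_
    · rw [hqP, eval_mul, eval_mul, eval_mul, eval_C]
      have := mul_nonneg (mul_self_nonneg (q.eval x)) (neg_nonneg.2 (h x hx))
      linarith
    · rw [weightedIntegral_C_mul, horth, mul_zero]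

theorem shiftedNodes_card_and_subset (hL : 0 < L) (hα : -1 / 2 < α) (m : ℕ) :
    (shiftedNodes L α m).card = m + 1 ∧ ∀ z ∈ shiftedNodes L α m, z ∈ Ioo 0 L := by
  have h1 := card_shiftedNodes_filter hL hα m
  have h2 : (shiftedNodes L α m).card ≤ m + 1 := by
    refine (Multiset.toFinset_card_le _).trans ((card_roots' _).trans ?_)
    rw [shiftedGegenbauer_natDegree hL hα]
  refine ⟨h2.antisymm (h1.trans (Finset.card_filter_le _ _)),
    Finset.filter_eq_self.1 (Finset.eq_of_subset_of_card_le
    (Finset.filter_subset _ _) (h2.trans h1))⟩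

/-- The quadrature integrates a polynomial of degree at most `m` that agrees with `f` at the
nodes. -/
theorem gegenbauerQuadrature_eq_integral (hL : 0 < L) (hα : -1 / 2 < α) (m : ℕ) (f : ℝ → ℝ) :
    ∃ g : ℝ[X], g.degree < (m + 1 : ℕ) ∧ (∀ z ∈ shiftedNodes L α m, g.eval z = f z) ∧
      ∀ x, gegenbauerQuadrature L α m f x = ∫ t in (0 : ℝ)..x, g.eval t := by
  have hmem := mem_shiftedNodes hL hα m
  -- The Christoffel number times the kernel at z is the Lagrange basis polynomial of z.
  refine ⟨∑ z ∈ shiftedNodes L α m, C (shiftedChristoffel L α m z * f z) *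
    christoffelKernel L α m z, ?_, fun z hz => ?_, fun x => ?_⟩
  · refine (degree_sum_le _ _).trans_lt
      ((Finset.sup_lt_iff (WithBot.bot_lt_coe _)).2 fun z _ => ?_)
    exact (smul_eq_C_mul (R := ℝ) _ ▸ degree_smul_le _ _).trans_lt (christoffelKernel_degree_lt hL hα m z)
  · rw [eval_finsetSum, Finset.sum_eq_single_of_mem z hz]
    · rw [eval_mul, eval_C, shiftedChristoffel_eq]
      have := (christoffelKernel_eval_self_pos hL hα m z).ne'
      field_simp
    · intro y hy hyz
      rw [eval_mul, christoffelKernel_eval_of_ne hL hα m ((hmem y).1 hy) ((hmem z).1 hz) hyz.symm,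
        mul_zero]
  · have hint : ∀ q : ℝ[X], IntervalIntegrable (fun t => q.eval t) MeasureTheory.volume 0 x :=
      fun q => q.continuous.intervalIntegrable _ _
    simp only [eval_finsetSum]
    rw [intervalIntegral.integral_finsetSum fun z _ => hint _]
    refine Finset.sum_congr rfl fun z _ => ?_
    simp only [eval_mul, eval_C, intervalIntegral.integral_const_mul, christoffelKernel_eval]
    rw [intervalIntegral.integral_finsetSum fun j _ => ((hint _).const_mul _)]
    simp only [intervalIntegral.integral_const_mul, integrationEntry]
    ring

end nodes

/-! ### Rolle's theorem and the interpolation remainder -/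

/-- Rolle between consecutive zeros; the open gaps are disjoint, so the new zeros are distinct. -/
theorem exists_finset_zeros_of_hasDerivAt {a b : ℝ} {f f' : ℝ → ℝ} {k : ℕ} {S : Finset ℝ}
    (hS : S.card = k + 1) (hSab : ∀ x ∈ S, x ∈ Icc a b) (hzero : ∀ x ∈ S, f x = 0)
    (hc : ContinuousOn f (Icc a b)) (hd : ∀ x ∈ Ioo a b, HasDerivAt f (f' x) x) :
    ∃ T : Finset ℝ, T.card = k ∧ (∀ x ∈ T, x ∈ Icc a b) ∧ ∀ x ∈ T, f' x = 0 := by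
  have hmem : ∀ i, S.orderEmbOfFin hS i ∈ S := S.orderEmbOfFin_mem hS
  have hex : ∀ i : Fin k, ∃ c ∈ Ioo (S.orderEmbOfFin hS i.castSucc) (S.orderEmbOfFin hS i.succ),
      f' c = 0 := by
    intro i
    have h1 := hSab _ (hmem i.castSucc)
    have h2 := hSab _ (hmem i.succ)
    refine exists_hasDerivAt_eq_zero ((S.orderEmbOfFin hS).strictMono i.castSucc_lt_succ)
      (hc.mono (Icc_subset_Icc h1.1 h2.2)) ?_ fun x hx => hd x ⟨h1.1.trans_lt hx.1, hx.2.trans_le h2.2⟩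
    rw [hzero _ (hmem _), hzero _ (hmem _)]
  choose c hcI hc0 using hex
  have hmono : StrictMono c := fun i j hij =>
    ((hcI i).2.trans_le ((S.orderEmbOfFin hS).monotone (Fin.succ_le_castSucc_iff.2 hij))).trans
      (hcI j).1
  refine ⟨Finset.univ.map ⟨c, hmono.injective⟩, by simp, ?_, ?_⟩
  · simp only [Finset.mem_map, Finset.mem_univ, true_and, Function.Embedding.coeFn_mk]
    rintro _ ⟨i, rfl⟩
    exact ⟨(hSab _ (hmem i.castSucc)).1.trans (hcI i).1.le,
      (hcI i).2.le.trans (hSab _ (hmem i.succ)).2⟩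
  · simp only [Finset.mem_map, Finset.mem_univ, true_and, Function.Embedding.coeFn_mk]
    rintro _ ⟨i, rfl⟩
    exact hc0 i

/-- The generalized Rolle theorem, for a chain of successive derivatives. -/
theorem exists_zero_of_iterated_hasDerivAt {a b : ℝ} (k : ℕ) (G : ℕ → ℝ → ℝ) {S : Finset ℝ}
    (hS : S.card = k + 1) (hSab : ∀ x ∈ S, x ∈ Icc a b) (hzero : ∀ x ∈ S, G 0 x = 0)
    (hc : ∀ j < k, ContinuousOn (G j) (Icc a b))
    (hd : ∀ j < k, ∀ x ∈ Ioo a b, HasDerivAt (G j) (G (j + 1) x) x) :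
    ∃ ξ ∈ Icc a b, G k ξ = 0 := by
  induction k generalizing G S with
  | zero =>
    obtain ⟨x, hx⟩ := Finset.card_pos.1 (by omega : 0 < S.card)
    exact ⟨x, hSab x hx, hzero x hx⟩
  | succ k ih =>
    obtain ⟨T, hT, hTab, hT0⟩ := exists_finset_zeros_of_hasDerivAt hS hSab hzero
      (hc 0 k.succ_pos) (hd 0 k.succ_pos)
    exact ih (fun j => G (j + 1)) hT hTab hT0 (fun j hj => hc _ (by omega))
      fun j hj => hd _ (by omega)

/-- The remainder of polynomial interpolation. -/
theorem interpolation_remainder {a b : ℝ} (hab : a < b) {n : ℕ} {f : ℝ → ℝ}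
    (hf : ContDiffOn ℝ n f (Icc a b)) {Z : Finset ℝ} (hZ : Z.card = n)
    (hZab : ∀ z ∈ Z, z ∈ Icc a b) {g : ℝ[X]} (hg : g.degree < n)
    (hgf : ∀ z ∈ Z, g.eval z = f z) {x : ℝ} (hx : x ∈ Icc a b) :
    ∃ ξ ∈ Icc a b, (f x - g.eval x) * n.factorial =
      iteratedDerivWithin n f (Icc a b) ξ * ∏ z ∈ Z, (x - z) := by
  by_cases hxZ : x ∈ Z
  · exact ⟨x, hx, by rw [hgf x hxZ, Finset.prod_eq_zero hxZ (sub_self x)]; simp⟩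
  set w := Lagrange.nodal Z (id : ℝ → ℝ) with hw
  have hwx : w.eval x = ∏ z ∈ Z, (x - z) := Lagrange.eval_nodal
  have hw0 : w.eval x ≠ 0 := by
    rw [hwx]
    exact Finset.prod_ne_zero_iff.2 fun z hz => sub_ne_zero.2 (by rintro rfl; exact hxZ hz)
  -- Chosen so that `h` agrees with `f` at x as well as on `Z`: f - h then has n + 1 zeros.
  set c := (f x - g.eval x) / w.eval x with hcdef
  set h := g + C c * w with hh
  have hwd : w.natDegree = n := by rw [hw, Lagrange.natDegree_nodal, hZ]
  have hgc : g.coeff n = 0 := coeff_eq_zero_of_degree_lt hg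
  have hhd : h.natDegree ≤ n := by
    refine (natDegree_add_le _ _).trans (max_le (natDegree_le_of_degree_le hg.le) ?_)
    exact (natDegree_C_mul_le _ _).trans hwd.le
  have hhc : h.coeff n = c := by
    have : w.coeff n = 1 := by rw [← hwd]; exact Lagrange.nodal_monic
    rw [hh, coeff_add, hgc, coeff_C_mul, this]; ring
  have hlast : derivative^[n] h = C (n.factorial * c) := by
    rw [eq_C_of_natDegree_le_zero ((natDegree_iterate_derivative h n).trans (by omega)),
      coeff_iterate_derivative, zero_add, hhc, Nat.descFactorial_self, nsmul_eq_mul]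
  have hU := uniqueDiffOn_Icc hab
  have hrolle : ∃ ξ ∈ Icc a b, iteratedDerivWithin n f (Icc a b) ξ -
      (derivative^[n] h).eval ξ = 0 := by
    refine exists_zero_of_iterated_hasDerivAt (a := a) (b := b) n
      (fun k t => iteratedDerivWithin k f (Icc a b) t - (derivative^[k] h).eval t)
      (S := insert x Z) (by rw [Finset.card_insert_of_notMem hxZ, hZ]) ?_ ?_ ?_ ?_
    · intro y hy
      rcases Finset.mem_insert.1 hy with rfl | hy
      exacts [hx, hZab y hy]
    · intro y hy
      simp only [iteratedDerivWithin_zero, Function.iterate_zero, id]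
      rw [hh, eval_add, eval_mul, eval_C]
      rcases Finset.mem_insert.1 hy with rfl | hy
      · rw [hcdef]; field_simp; ring
      · rw [hgf y hy, hw, show y = (id : ℝ → ℝ) y from rfl, Lagrange.eval_nodal_at_node hy]; simp
    · intro j hj
      exact (hf.continuousOn_iteratedDerivWithin (by exact_mod_cast hj.le) hU).sub
        (Polynomial.continuous _).continuousOn
    · intro j hj y hy
      have hnhds : Icc a b ∈ nhds y := Icc_mem_nhds hy.1 hy.2
      have h1 := ((hf.differentiableOn_iteratedDerivWithin (m := j) (by exact_mod_cast hj) hU) y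
        (Ioo_subset_Icc_self hy)).hasDerivWithinAt.hasDerivAt hnhds
      rw [← iteratedDerivWithin_succ] at h1
      rw [Function.iterate_succ_apply']
      exact h1.fun_sub (Polynomial.hasDerivAt _ y)
  obtain ⟨ξ, hξ, h0⟩ := hrolle
  refine ⟨ξ, hξ, ?_⟩
  rw [hlast, eval_C, sub_eq_zero] at h0
  rw [h0, ← hwx, hcdef]
  field_simp

/-! ### Uniform error bound and convergence -/

/-- The error of the shifted Gegenbauer quadrature, uniformly in the parameter. -/
theorem abs_gegenbauerQuadrature_sub_integral_le {L α A : ℝ} (hL : 0 < L) (hα : -1 / 2 < α)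
    (m : ℕ) {f : ℝ → ℝ} (hf : ContDiffOn ℝ ((m + 1 : ℕ) : WithTop ℕ∞) f (Icc 0 L))
    (hA : ∀ y ∈ Icc 0 L, |iteratedDerivWithin (m + 1) f (Icc 0 L) y| ≤ A) {x : ℝ}
    (hx : x ∈ Icc 0 L) :
    |gegenbauerQuadrature L α m f x - ∫ t in (0 : ℝ)..x, f t| ≤
      A * L * (L ^ (m + 1) / (m + 1).factorial) := by
  obtain ⟨g, hg, hgf, hQ⟩ := gegenbauerQuadrature_eq_integral hL hα m f
  obtain ⟨hcard, hsub⟩ := shiftedNodes_card_and_subset hL hα m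
  have hA0 : 0 ≤ A := (abs_nonneg _).trans (hA x hx)
  have hpt : ∀ t ∈ Icc 0 L, |g.eval t - f t| ≤ A * (L ^ (m + 1) / (m + 1).factorial) := by
    intro t ht
    obtain ⟨ξ, hξ, h⟩ := interpolation_remainder hL hf hcard
      (fun z hz => Ioo_subset_Icc_self (hsub z hz)) hg hgf ht
    have hfac : (0 : ℝ) < (m + 1).factorial := by exact_mod_cast (m + 1).factorial_pos
    -- A crude bound, free of α, is enough: the factorial beats L^(m+1).
    have hprod : |∏ z ∈ shiftedNodes L α m, (t - z)| ≤ L ^ (m + 1) := by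
      rw [Finset.abs_prod, ← hcard, ← Finset.prod_const]
      refine Finset.prod_le_prod (fun _ _ => abs_nonneg _) fun z hz => ?_
      have := hsub z hz
      rw [abs_le]
      constructor <;> linarith [ht.1, ht.2, this.1, this.2]
    rw [abs_sub_comm, mul_div_assoc', le_div_iff₀ hfac]
    calc |f t - g.eval t| * (m + 1).factorial = |(f t - g.eval t) * (m + 1).factorial| := by
          rw [abs_mul, abs_of_pos hfac]
      _ ≤ A * L ^ (m + 1) := by
          rw [h, abs_mul]
          exact mul_le_mul (hA ξ hξ) hprod (abs_nonneg _) hA0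
  have hfi : IntervalIntegrable f MeasureTheory.volume 0 x := by
    refine ContinuousOn.intervalIntegrable ?_
    rw [uIcc_of_le hx.1]
    exact hf.continuousOn.mono (Icc_subset_Icc le_rfl hx.2)
  rw [hQ, ← intervalIntegral.integral_sub (g.continuous.intervalIntegrable _ _) hfi]
  have := intervalIntegral.norm_integral_le_of_norm_le_const (a := 0) (b := x)
    (f := fun t => g.eval t - f t) (C := A * (L ^ (m + 1) / (m + 1).factorial)) fun t ht => by
      rw [uIoc_of_le hx.1] at ht
      exact hpt t ⟨ht.1.le, ht.2.trans hx.2⟩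
  rw [Real.norm_eq_abs, sub_zero, abs_of_nonneg hx.1] at this
  refine this.trans ?_
  rw [mul_right_comm]
  gcongr
  exact hx.2

theorem mainTheorem9 (L : ℝ) (hL : 0 < L) (A : ℝ) (hA : 0 < A) (ε : ℝ) (hε : 0 < ε) :
    ∃ M : ℕ, ∀ m : ℕ, M ≤ m → 1 ≤ m →
      ∀ f : ℝ → ℝ, ContDiffOn ℝ ((m + 1 : ℕ) : WithTop ℕ∞) f (Icc 0 L) →
        (∀ y ∈ Icc 0 L, |iteratedDerivWithin (m + 1) f (Icc 0 L) y| ≤ A) →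
      ∀ (n : ℕ) (x : Fin (n + 1) → ℝ), (∀ i, x i ∈ Icc 0 L) →
      ∀ α : Fin (n + 1) → ℝ, (∀ i, IsOptimalParameter L m (x i) (α i)) →
        ‖(fun i => gegenbauerQuadrature L (α i) m f (x i)) -
            (fun i => chebyshevQuadrature L m f (x i))‖ < ε := by
  have hlim := ((FloorSemiring.tendsto_pow_div_factorial_atTop L).comp
    (Filter.tendsto_add_atTop_nat 1)).const_mul (A * L)
  rw [mul_zero] at hlim
  obtain ⟨M, hM⟩ := Filter.eventually_atTop.1 (hlim.eventually (gt_mem_nhds (half_pos hε)))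
  -- `M` comes from L, A and ε alone; each quadrature is within ε/2 of the exact integral.
  refine ⟨M, fun m hm _ f hf hfA n x hx α hα => (pi_norm_lt_iff hε).2 fun i => ?_⟩
  have hb : A * L * (L ^ (m + 1) / (m + 1).factorial) < ε / 2 := hM m hm
  have h1 := abs_gegenbauerQuadrature_sub_integral_le hL (hα i).1 m hf hfA (hx i)
  have h2 := abs_gegenbauerQuadrature_sub_integral_le hL (α := 0) (by norm_num) m hf hfA (hx i)
  rw [Pi.sub_apply, Real.norm_eq_abs, chebyshevQuadrature]
  rw [abs_le] at h1 h2
  rw [abs_lt]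
  constructor <;> linarith [h1.1, h1.2, h2.1, h2.2]
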